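/- Let $\Bbbk$ be an algebraically closed field, $A$ a finite dimensional unital associative $\Bbbk$-algebra, and $A\text{-}\mathrm{mod}$ the category of finite dimensional left $A$-modules. Let $\mathrm{F}$ be an additive $\Bbbk$-linear endofunctor of $A\text{-}\mathrm{mod}$ that is selfadjoint (i.e. $\mathrm{F}$ is left, equivalently right, adjoint to itself) and satisfies $\mathrm{F}\circ\mathrm{F}\cong\mathrm{F}$. Then there is an isomorphism of $\Bbbk$-algebras $A\cong B\oplus C$, where each of $B$ and $C$ is a unital $\Bbbk$-algebra or zero, such that $\mathrm{F}\cong\mathfrak{p}_B$. Here $\mathfrak{p}_B=\mathrm{ID}\boxplus\mathbf{0}$ is the endofunctor of $A\text{-}\mathrm{mod}=B\text{-}\mathrm{mod}\oplus C\text{-}\mathrm{mod}$ which acts componentwise, as the identity functor on the component in $B\text{-}\mathrm{mod}$ and as the zero functor on the component in $C\text{-}\mathrm{mod}$. -/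

import Mathlib

open CategoryTheory

universe u v w

namespace AlgebraDecomposition

section Component

variable {A : Type u} {B : Type v} {C : Type w} [Ring A] [Ring B] [Ring C]

/-- The central idempotent `1_B` of `A` belonging to the summand `B` of a decomposition
`A ≅ B × C` of rings. -/
def idem (e : A ≃+* B × C) : A := e.symm (1, 0)

theorem idem_mul (e : A ≃+* B × C) (b : B) : idem e * e.symm (b, 0) = e.symm (b, 0) := by
  simp [idem, ← map_mul]

theorem idem_mul_idem (e : A ≃+* B × C) : idem e * idem e = idem e := idem_mul e 1

theorem symm_fst_zero (e : A ≃+* B × C) (a : A) : e.symm ((e a).1, 0) = idem e * a := by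
  apply e.injective
  ext <;> simp [idem]

theorem idem_comm (e : A ≃+* B × C) (a : A) : idem e * a = a * idem e := by
  apply e.injective
  ext <;> simp [idem]

/-- The `B`-component `1_B M` of an `A`-module `M`, for a decomposition `A ≅ B × C`. -/
def component (e : A ≃+* B × C) (M : Type*) [AddCommGroup M] [Module A M] : AddSubgroup M :=
  (DistribSMul.toAddMonoidHom M (idem e)).range

theorem mem_component {e : A ≃+* B × C} {M : Type*} [AddCommGroup M] [Module A M] {m : M} :
    m ∈ component e M ↔ idem e • m = m := by
  constructor
  · rintro ⟨n, rfl⟩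
    simp [smul_smul, idem_mul_idem]
  · intro h
    exact ⟨m, h⟩

/-- `B` acts on `1_B M` through `b ↦ (b, 0)`. -/
instance componentModule (e : A ≃+* B × C) (M : Type*) [AddCommGroup M] [Module A M] :
    Module B (component e M) where
  smul b m := ⟨e.symm (b, 0) • (m : M), by
    rw [mem_component, smul_smul, idem_mul]⟩
  one_smul m := Subtype.ext (mem_component.1 m.2)
  mul_smul b c m := Subtype.ext <| by
    change e.symm (b * c, 0) • (m : M) = e.symm (b, 0) • e.symm (c, 0) • (m : M)
    rw [smul_smul, ← map_mul, Prod.mk_mul_mk, mul_zero]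
  smul_zero b := Subtype.ext (smul_zero (e.symm (b, 0)))
  smul_add b m n := Subtype.ext (smul_add (e.symm (b, 0)) (m : M) (n : M))
  add_smul b c m := Subtype.ext <| by
    change e.symm (b + c, 0) • (m : M) = e.symm (b, 0) • (m : M) + e.symm (c, 0) • (m : M)
    rw [← add_smul, ← map_add, Prod.mk_add_mk, add_zero]
  zero_smul m := Subtype.ext <| by
    change e.symm ((0 : B), (0 : C)) • (m : M) = 0
    rw [← Prod.zero_eq_mk, map_zero, zero_smul]

theorem coe_smul (e : A ≃+* B × C) {M : Type*} [AddCommGroup M] [Module A M] (b : B)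
    (m : component e M) : ((b • m : component e M) : M) = e.symm (b, 0) • (m : M) := rfl

/-- The projection `m ↦ 1_B m`, semilinear over the ring projection `A → B`. -/
def toComponent (e : A ≃+* B × C) (M : Type*) [AddCommGroup M] [Module A M] :
    M →ₛₗ[(RingHom.fst B C).comp (e : A →+* B × C)] component e M where
  toFun m := ⟨idem e • m, m, rfl⟩
  map_add' m n := Subtype.ext (smul_add _ _ _)
  map_smul' a m := Subtype.ext <| by
    change idem e • a • m = e.symm ((e a).1, 0) • idem e • m
    rw [symm_fst_zero, smul_smul, smul_smul, mul_assoc, ← idem_comm e a, ← mul_assoc,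
      idem_mul_idem]

instance component_finite (e : A ≃+* B × C) (M : Type*) [AddCommGroup M] [Module A M]
    [Module.Finite A M] : Module.Finite B (component e M) := by
  have : RingHomSurjective ((RingHom.fst B C).comp (e : A →+* B × C)) :=
    ⟨fun b => ⟨e.symm (b, 0), by simp⟩⟩
  refine Module.Finite.of_surjective (toComponent e M) ?_
  rintro ⟨_, n, rfl⟩
  exact ⟨n, rfl⟩

/-- The restriction `1_B M → 1_B N` of an `A`-linear map `M → N`. -/
def componentMap (e : A ≃+* B × C) {M N : Type*} [AddCommGroup M] [Module A M]
    [AddCommGroup N] [Module A N] (f : M →ₗ[A] N) : component e M →ₗ[B] component e N where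
  toFun m := ⟨f m, by rw [mem_component, ← map_smul, mem_component.1 m.2]⟩
  map_add' m n := Subtype.ext (map_add f (m : M) (n : M))
  map_smul' b m := Subtype.ext (map_smul f (e.symm (b, 0)) (m : M))

/-- The `A`-module structure `a • (x, y) = (b • x, c • y)`, where `a` corresponds to `(b, c)`,
on the product of a `B`-module and a `C`-module. -/
abbrev prodModule (e : A ≃+* B × C) (X Y : Type*) [AddCommGroup X] [AddCommGroup Y]
    [Module B X] [Module C Y] : Module A (X × Y) where
  smul a p := ((e a).1 • p.1, (e a).2 • p.2)
  one_smul p := by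
    change ((e 1).1 • p.1, (e 1).2 • p.2) = p
    simp
  mul_smul a b p := by
    change ((e (a * b)).1 • p.1, (e (a * b)).2 • p.2) =
      ((e a).1 • (e b).1 • p.1, (e a).2 • (e b).2 • p.2)
    simp [mul_smul]
  smul_zero a := by
    change ((e a).1 • (0 : X), (e a).2 • (0 : Y)) = 0
    simp
  smul_add a p q := by
    change ((e a).1 • (p.1 + q.1), (e a).2 • (p.2 + q.2)) =
      ((e a).1 • p.1, (e a).2 • p.2) + ((e a).1 • q.1, (e a).2 • q.2)
    simp
  add_smul a b p := by
    change ((e (a + b)).1 • p.1, (e (a + b)).2 • p.2) =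
      ((e a).1 • p.1, (e a).2 • p.2) + ((e b).1 • p.1, (e b).2 • p.2)
    simp [add_smul]
  zero_smul p := by
    change ((e 0).1 • p.1, (e 0).2 • p.2) = 0
    simp

theorem prodModule_finite (e : A ≃+* B × C) (X Y : Type*) [AddCommGroup X] [AddCommGroup Y]
    [Module B X] [Module C Y] [Module.Finite B X] [Module.Finite C Y] :
    letI := prodModule e X Y
    Module.Finite A (X × Y) := by
  let _ := prodModule e X Y
  have hs : ∀ (a : A) (p : X × Y), a • p = ((e a).1 • p.1, (e a).2 • p.2) := fun _ _ => rfl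
  obtain ⟨s, hs1⟩ := (Module.Finite.fg_top : (⊤ : Submodule B X).FG)
  obtain ⟨t, ht1⟩ := (Module.Finite.fg_top : (⊤ : Submodule C Y).FG)
  classical
  refine ⟨⟨s.image (fun x => (x, 0)) ∪ t.image (fun y => (0, y)), ?_⟩⟩
  set S := Submodule.span A
    ((s.image (fun x => ((x, 0) : X × Y)) ∪ t.image (fun y => ((0, y) : X × Y)) :
      Finset (X × Y)) : Set (X × Y)) with hS
  have h1 : ∀ x : X, ((x, 0) : X × Y) ∈ S := by
    intro x
    have hx : x ∈ Submodule.span B (s : Set X) := hs1 ▸ Submodule.mem_top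
    induction hx using Submodule.span_induction with
    | mem x hx => exact Submodule.subset_span (by simp_all)
    | zero => exact S.zero_mem
    | add x y _ _ hx hy => simpa using S.add_mem hx hy
    | smul b x _ hx => simpa [hs] using S.smul_mem (e.symm (b, 0)) hx
  have h2 : ∀ y : Y, ((0, y) : X × Y) ∈ S := by
    intro y
    have hy : y ∈ Submodule.span C (t : Set Y) := ht1 ▸ Submodule.mem_top
    induction hy using Submodule.span_induction with
    | mem x hx => exact Submodule.subset_span (by simp_all)
    | zero => exact S.zero_mem
    | add x y _ _ hx hy => simpa using S.add_mem hx hy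
    | smul c x _ hx => simpa [hs] using S.smul_mem (e.symm (0, c)) hx
  rw [eq_top_iff]
  rintro ⟨x, y⟩ -
  simpa using S.add_mem (h1 x) (h2 y)

end Component

section Functors

variable {A B C : Type u} [Ring A] [Ring B] [Ring C]

/-- The component functor `A-mod ⥤ B-mod`, `M ↦ 1_B M`. -/
def componentFunctor (e : A ≃+* B × C) : FGModuleCat.{u} A ⥤ FGModuleCat.{u} B where
  obj M := FGModuleCat.of B (component e M)
  map f := FGModuleCat.ofHom (componentMap e f.hom.hom)

/-- The swapped decomposition `A ≅ C × B`. -/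
abbrev swap (e : A ≃+* B × C) : A ≃+* C × B := e.trans RingEquiv.prodComm

/-- The functor `B-mod × C-mod ⥤ A-mod` which sends `(X, Y)` to `X × Y`, on which
`A ≅ B × C` acts componentwise. -/
def prodFunctor (e : A ≃+* B × C) :
    FGModuleCat.{u} B × FGModuleCat.{u} C ⥤ FGModuleCat.{u} A where
  obj P :=
    letI := prodModule e P.1 P.2
    haveI := prodModule_finite e P.1 P.2
    FGModuleCat.of A (P.1 × P.2)
  map {P Q} f :=
    letI := prodModule e P.1 P.2
    haveI := prodModule_finite e P.1 P.2
    letI := prodModule e Q.1 Q.2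
    haveI := prodModule_finite e Q.1 Q.2
    FGModuleCat.ofHom
      { toFun := fun p => (f.1.hom.hom p.1, f.2.hom.hom p.2)
        map_add' := fun p q => Prod.ext (map_add f.1.hom.hom p.1 q.1) (map_add f.2.hom.hom p.2 q.2)
        map_smul' := fun a p => Prod.ext (map_smul f.1.hom.hom (e a).1 p.1)
          (map_smul f.2.hom.hom (e a).2 p.2) }

/-- The external direct sum `F ⊞ G` on `A-mod`, for `A ≅ B × C`, of an endofunctor `F` of `B-mod`
and an endofunctor `G` of `C-mod`: it acts on `A`-modules componentwise. -/
def externalSum (e : A ≃+* B × C) (F : FGModuleCat.{u} B ⥤ FGModuleCat.{u} B)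
    (G : FGModuleCat.{u} C ⥤ FGModuleCat.{u} C) : FGModuleCat.{u} A ⥤ FGModuleCat.{u} A :=
  (componentFunctor e).prod' (componentFunctor (swap e)) ⋙ F.prod G ⋙ prodFunctor e

/-- The zero endofunctor. -/
def zeroFunctor (C : Type u) [Ring C] : FGModuleCat.{u} C ⥤ FGModuleCat.{u} C :=
  (Functor.const _).obj (FGModuleCat.of C PUnit.{u + 1})

/-- The projection `𝔭_B = ID ⊞ 0` with respect to a decomposition `A ≅ B × C`, as an endofunctor
of `A-mod`. -/
def projection (e : A ≃+* B × C) : FGModuleCat.{u} A ⥤ FGModuleCat.{u} A :=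
  externalSum e (𝟭 (FGModuleCat.{u} B)) (zeroFunctor C)

end Functors

end AlgebraDecomposition

/-!
Let `ε : FF ⟶ 1` and `η : 1 ⟶ FF` be the counit and the unit of `F ⊣ F`. By a triangle identity,
`ε` at `F M` is a split epimorphism `FFF M ⟶ F M`, whose source and target are isomorphic because
`FF ≅ F`; since surjective endomorphisms of finitely generated modules are injective, it is
invertible. By naturality `ε ≫ η` is then invertible, so `F ≅ FF` is a retract of the identity
functor. The corresponding idempotent endomorphism of the identity functor is multiplication by a
central idempotent `z` of `A`, and `F` is the projection belonging to `A ≅ A/(1 - z) × A/(z)`.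
-/

namespace AlgebraDecomposition

section CentralIdempotent

variable {A : Type u} [Ring A]

instance isTwoSided_span_singleton (z : Subring.center A) :
    (Ideal.span {(z : A)}).IsTwoSided where
  mul_mem_of_left {a} b ha := by
    obtain ⟨c, rfl⟩ := Ideal.mem_span_singleton'.1 ha
    rw [mul_assoc, ← Subring.mem_center_iff.1 z.2 b, ← mul_assoc]
    exact Ideal.mem_span_singleton'.2 ⟨c * b, rfl⟩

variable (k : Type v) [CommSemiring k] [Algebra k A] {z : Subring.center A}

theorem bijective_mkₐ_prod_mkₐ (hz : IsIdempotentElem z) :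
    Function.Bijective ((Ideal.Quotient.mkₐ k (Ideal.span {((1 - z : Subring.center A) : A)})).prod
      (Ideal.Quotient.mkₐ k (Ideal.span {(z : A)}))) := by
  have hz : (z : A) * z = z := congrArg Subtype.val hz
  constructor
  · refine (injective_iff_map_eq_zero _).2 fun a ha => ?_
    obtain ⟨b, hb⟩ :=
      Ideal.mem_span_singleton'.1 (Ideal.Quotient.eq_zero_iff_mem.1 (congrArg Prod.fst ha))
    obtain ⟨c, hc⟩ :=
      Ideal.mem_span_singleton'.1 (Ideal.Quotient.eq_zero_iff_mem.1 (congrArg Prod.snd ha))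
    calc
      a = a * z := by rw [← hc, mul_assoc, hz]
      _ = 0 := by simp [← hb, mul_assoc, sub_mul, hz]
  · rintro ⟨x, y⟩
    obtain ⟨a, rfl⟩ := Ideal.Quotient.mk_surjective x
    obtain ⟨b, rfl⟩ := Ideal.Quotient.mk_surjective y
    refine ⟨a * z + b * (1 - z), Prod.ext (Ideal.Quotient.eq.2 ?_) (Ideal.Quotient.eq.2 ?_)⟩
    · refine Ideal.mem_span_singleton'.2 ⟨b - a, ?_⟩
      rw [AddSubgroupClass.coe_sub, OneMemClass.coe_one]
      noncomm_ring
    · refine Ideal.mem_span_singleton'.2 ⟨a - b, ?_⟩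
      noncomm_ring

/-- The decomposition `A ≅ A/(1 - z) × A/(z)` of an algebra given by a central idempotent `z`. -/
noncomputable def prodQuotientAlgEquiv (hz : IsIdempotentElem z) :
    A ≃ₐ[k] (A ⧸ Ideal.span {((1 - z : Subring.center A) : A)}) × A ⧸ Ideal.span {(z : A)} :=
  AlgEquiv.ofBijective _ (bijective_mkₐ_prod_mkₐ k hz)

theorem idem_prodQuotientAlgEquiv (hz : IsIdempotentElem z) :
    idem (prodQuotientAlgEquiv k hz).toRingEquiv = z := by
  refine (RingEquiv.symm_apply_eq _).2 (Prod.ext (Eq.symm (Ideal.Quotient.eq.2 ?_))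
    (Eq.symm (Ideal.Quotient.eq_zero_iff_mem.2 (Ideal.mem_span_singleton_self _))))
  exact Ideal.mem_span_singleton'.2 ⟨-1, by simp⟩

end CentralIdempotent

section Retract

variable {D : Type*} [Category* D]

/-- The isomorphism between two splittings of the same idempotent. -/
def isoOfRetracts {X Y Z : D} (ρ : Retract X Z) (σ : Retract Y Z) (h : ρ.r ≫ ρ.i = σ.r ≫ σ.i) :
    X ≅ Y where
  hom := ρ.i ≫ σ.r
  inv := σ.i ≫ ρ.r
  hom_inv_id := by simp [← reassoc_of% h]
  inv_hom_id := by simp [reassoc_of% h]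

theorem isIdempotentElem_retract {F : D ⥤ D} (ρ : Retract F (𝟭 D)) :
    IsIdempotentElem (M := CatCenter D) (ρ.r ≫ ρ.i) :=
  show (ρ.r ≫ ρ.i) ≫ ρ.r ≫ ρ.i = ρ.r ≫ ρ.i by simp

end Retract

section SelfAdjoint

variable {D : Type*} [Category* D]

theorem isIso_of_comp_eq_id_of_iso {X Y : D} [IsDedekindFiniteMonoid (End X)] {f : X ⟶ Y}
    {s : Y ⟶ X} (h : s ≫ f = 𝟙 Y) (i : Y ≅ X) : IsIso f := by
  have hX : (i.inv ≫ s) ≫ f ≫ i.hom = 𝟙 X := by simp [reassoc_of% h]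
  have hX' : (f ≫ i.hom) ≫ i.inv ≫ s = 𝟙 X :=
    mul_eq_one_symm (M := End X) (a := f ≫ i.hom) (b := i.inv ≫ s) hX
  exact ⟨s, by simpa using hX', h⟩

theorem isIso_counit_comp_unit {F : D ⥤ D} (adj : F ⊣ F)
    [∀ X, IsIso (adj.counit.app (F.obj X))] : IsIso (adj.counit ≫ adj.unit) := by
  refine (NatTrans.isIso_iff_isIso_app _).2 fun X => ?_
  have : IsIso (F.map (adj.unit.app X)) :=
    isIso_of_comp_hom_eq_id _ (adj.left_triangle_components X)
  have hnat : F.map (F.map (adj.unit.app X)) ≫ adj.counit.app (F.obj (F.obj X)) =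
      adj.counit.app X ≫ adj.unit.app X := adj.counit_naturality (adj.unit.app X)
  rw [NatTrans.comp_app, ← hnat]
  infer_instance

theorem nonempty_retract_id [∀ X : D, IsDedekindFiniteMonoid (End X)] {F : D ⥤ D} (adj : F ⊣ F)
    (i : F ⋙ F ≅ F) : Nonempty (Retract F (𝟭 D)) := by
  have (X : D) : IsIso (adj.counit.app (F.obj X)) :=
    isIso_of_comp_eq_id_of_iso (adj.left_triangle_components X)
      ((i.app X).symm ≪≫ F.mapIso (i.app X).symm)
  have := isIso_counit_comp_unit adj
  let σ : Retract (F ⋙ F) (𝟭 D) :=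
    { i := adj.counit
      r := adj.unit ≫ inv (adj.counit ≫ adj.unit)
      retract := by rw [← Category.assoc, IsIso.hom_inv_id] }
  exact ⟨(Retract.ofIso i.symm).trans σ⟩

end SelfAdjoint

section FGModuleCat

variable {A : Type u} [Ring A]

instance isDedekindFiniteMonoid_moduleEnd [OrzechProperty A] (M : Type*) [AddCommGroup M]
    [Module A M] [Module.Finite A M] : IsDedekindFiniteMonoid (Module.End A M) where
  mul_eq_one_symm {f g} h := by
    have hfg (m : M) : f (g m) = m := LinearMap.congr_fun h m
    have hf : Function.Injective f :=
      OrzechProperty.injective_of_surjective_endomorphism f fun m => ⟨g m, hfg m⟩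
    exact LinearMap.ext fun m => hf (hfg (f m))

instance isDedekindFiniteMonoid_end [OrzechProperty A] (M : FGModuleCat.{w} A) :
    IsDedekindFiniteMonoid (End M) where
  mul_eq_one_symm {f g} h := FGModuleCat.hom_ext <|
    mul_eq_one_symm (a := f.hom.hom) (b := g.hom.hom) congr(($h).hom.hom)

theorem catCenter_app_apply (t : CatCenter (FGModuleCat.{u} A)) (M : FGModuleCat.{u} A) (m : M) :
    (t.app M).hom.hom m = ((t.app (FGModuleCat.of A A)).hom.hom (1 : A) : A) • m := by
  have hnat := t.naturality (X := FGModuleCat.of A A) (Y := M)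
    (FGModuleCat.ofHom (LinearMap.toSpanSingleton A M m))
  calc
    (t.app M).hom.hom m = (t.app M).hom.hom ((1 : A) • m) := by rw [one_smul]
    _ = ((t.app (FGModuleCat.of A A)).hom.hom (1 : A) : A) • m := congr(($hnat).hom.hom (1 : A))

/-- The value at `1 : A` of an element of the center of the category of finitely generated
`A`-modules, as an element of the center of `A`. -/
def centerEval : CatCenter (FGModuleCat.{u} A) →* Subring.center A where
  toFun t := ⟨(t.app (FGModuleCat.of A A)).hom.hom (1 : A), Subring.mem_center_iff.2 fun a => by
    have h := catCenter_app_apply t (FGModuleCat.of A A) a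
    have h' := map_smul (t.app (FGModuleCat.of A A)).hom.hom a (1 : A)
    rw [smul_eq_mul, mul_one] at h'
    exact h'.symm.trans h⟩
  map_one' := rfl
  map_mul' s t := Subtype.ext (catCenter_app_apply s (FGModuleCat.of A A) _)

theorem centerEval_injective : Function.Injective (centerEval (A := A)) := fun s t h =>
  CatCenter.ext s t fun M => FGModuleCat.hom_ext <| LinearMap.ext fun m => by
    rw [catCenter_app_apply s, catCenter_app_apply t]
    exact congrArg (fun z : Subring.center A => (z : A) • m) h

end FGModuleCat

section Projection

variable {A B C : Type u} [Ring A] [Ring B] [Ring C]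

/-- The projection `𝔭_B` as a retract of the identity functor, through the inclusions
`1_B M → M` and the maps `M → 1_B M`, `m ↦ 1_B m`. -/
def projectionRetract (e : A ≃+* B × C) : Retract (projection e) (𝟭 (FGModuleCat.{u} A)) where
  i :=
    { app M := ObjectProperty.homMk <| ModuleCat.ofHom (X := ((projection e).obj M).carrier)
        { toFun p := p.1.1
          map_add' _ _ := rfl
          map_smul' a p := by
            change e.symm ((e a).1, 0) • p.1.1 = a • p.1.1
            rw [symm_fst_zero, idem_comm, mul_smul, mem_component.1 p.1.2] } }
  r :=
    { app M := ObjectProperty.homMk <| ModuleCat.ofHom (Y := ((projection e).obj M).carrier)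
        { toFun m := (toComponent e M m, PUnit.unit)
          map_add' m n := Prod.ext (map_add (toComponent e M) m n) rfl
          map_smul' a m := Prod.ext ((toComponent e M).map_smulₛₗ a m) rfl }
      naturality M N f := FGModuleCat.hom_ext <| LinearMap.ext fun m =>
        Prod.ext (Subtype.ext (map_smul f.hom.hom (idem e) m).symm) rfl }
  retract := NatTrans.ext <| funext fun M => FGModuleCat.hom_ext <| LinearMap.ext fun p =>
    Prod.ext (Subtype.ext (mem_component.1 p.1.2)) rfl

theorem centerEval_projectionRetract (e : A ≃+* B × C) :
    (centerEval ((projectionRetract e).r ≫ (projectionRetract e).i) : A) = idem e :=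
  mul_one (idem e)

theorem nonempty_iso_projection (e : A ≃+* B × C) {F : FGModuleCat.{u} A ⥤ FGModuleCat.{u} A}
    (ρ : Retract F (𝟭 _)) (he : idem e = centerEval (ρ.r ≫ ρ.i)) :
    Nonempty (F ≅ projection e) :=
  ⟨isoOfRetracts ρ (projectionRetract e) <| centerEval_injective <| Subtype.ext <|
    he.symm.trans (centerEval_projectionRetract e).symm⟩

end Projection

end AlgebraDecomposition

theorem mainTheorem2_general {k : Type v} [CommSemiring k] {A : Type u} [Ring A] [Algebra k A]
    [OrzechProperty A] (F : FGModuleCat.{u} A ⥤ FGModuleCat.{u} A)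
    (hadj : Nonempty (F ⊣ F)) (hidem : Nonempty (F ⋙ F ≅ F)) :
    ∃ (B C : Type u) (_ : Ring B) (_ : Ring C) (_ : Algebra k B) (_ : Algebra k C)
      (e : A ≃ₐ[k] B × C),
      Nonempty (F ≅ AlgebraDecomposition.projection (e : A ≃+* B × C)) := by
  obtain ⟨adj⟩ := hadj
  obtain ⟨i⟩ := hidem
  obtain ⟨ρ⟩ := AlgebraDecomposition.nonempty_retract_id adj i
  have hz := (AlgebraDecomposition.isIdempotentElem_retract ρ).map AlgebraDecomposition.centerEval
  exact ⟨_, _, _, _, _, _, AlgebraDecomposition.prodQuotientAlgEquiv k hz,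
    AlgebraDecomposition.nonempty_iso_projection _ ρ
      (AlgebraDecomposition.idem_prodQuotientAlgEquiv k hz)⟩

theorem mainTheorem2 {k : Type v} [Field k] [IsAlgClosed k]
    {A : Type u} [Ring A] [Algebra k A] [FiniteDimensional k A]
    (F : FGModuleCat.{u} A ⥤ FGModuleCat.{u} A) [F.Additive] [F.Linear k]
    (hadj : Nonempty (F ⊣ F)) (hidem : Nonempty (F ⋙ F ≅ F)) :
    ∃ (B C : Type u) (_ : Ring B) (_ : Ring C) (_ : Algebra k B) (_ : Algebra k C)
      (e : A ≃ₐ[k] B × C),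
      Nonempty (F ≅ AlgebraDecomposition.projection (e : A ≃+* B × C)) := by
  have : IsNoetherianRing A := IsNoetherianRing.of_finite k A
  exact mainTheorem2_general F hadj hidem
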